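/- Let $K$ be a field of characteristic zero and let $\tilde h_1,\tilde h_2,\tilde h_3,\tilde h_4\in K[x,y]$. Consider the polynomial map $$\tilde h=(z+\tilde h_1(x,y),\ w+\tilde h_2(x,y),\ \tilde h_3(x,y),\ \tilde h_4(x,y))$$ of $K^4$ with coordinates $(x,y,z,w)$. Suppose that its Jacobian matrix $J\tilde h$ is nilpotent and that its four components are linearly dependent over $K$. Then there exists $T\in\operatorname{GL}_4(K)$ such that $$T^{-1}\circ\tilde h\circ T=(0,w,0,0)+\tilde H,$$ where $\tilde H$ has one of the following two forms: 1. $\tilde H=(z+a(y),\ \beta,\ c(y),\ 0)$ with $a,c\in K[t]$ and $\beta\in K$; 2. $\tilde H=(z-2\alpha y\,b-\delta y+\rho,\ b,\ \alpha b^2+\delta b+\varepsilon,\ 0)$, where $b=g(x+\alpha y^2)$ with $g\in K[t]$ and $\alpha,\delta,\rho,\varepsilon\in K$. -/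

import Mathlib

/-- A polynomial map `K^n → K^n`, given by its `n` components in `K[x_1, …, x_n]`. -/
abbrev PolyMap (n : ℕ) (K : Type*) [CommSemiring K] : Type _ :=
  Fin n → MvPolynomial (Fin n) K

namespace PolyMap

open MvPolynomial

/-- The Jacobian matrix `JF = (∂F_i/∂x_j)`. -/
noncomputable def jacobian {n : ℕ} {K : Type*} [CommSemiring K] (F : PolyMap n K) :
    Matrix (Fin n) (Fin n) (MvPolynomial (Fin n) K) :=
  Matrix.of fun i j => pderiv j (F i)

/-- The linear polynomial map `x ↦ A x`. -/
noncomputable def ofMatrix {n : ℕ} {K : Type*} [CommSemiring K]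
    (A : Matrix (Fin n) (Fin n) K) : PolyMap n K :=
  fun i => ∑ j, C (A i j) * X j

/-- Composition `F ∘ G`: substitute the components of `G` for the variables of `F`. -/
noncomputable def comp {n : ℕ} {K : Type*} [CommSemiring K] (F G : PolyMap n K) :
    PolyMap n K :=
  fun i => aeval G (F i)

/-- `T⁻¹ ∘ F ∘ T` for an invertible linear map `T`. -/
noncomputable def conj {n : ℕ} {K : Type*} [Field K] (T : GL (Fin n) K) (F : PolyMap n K) :
    PolyMap n K :=
  comp (ofMatrix ((T⁻¹ : GL (Fin n) K) : Matrix (Fin n) (Fin n) K))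
    (comp F (ofMatrix (T : Matrix (Fin n) (Fin n) K)))

/-- A polynomial in the two variables `x, y`, viewed in `K[x, y, z, w]`. -/
noncomputable def liftXY {K : Type*} [CommSemiring K] (p : MvPolynomial (Fin 2) K) :
    MvPolynomial (Fin 4) K :=
  rename (Fin.castLE (by norm_num : 2 ≤ 4)) p

/-- The map `(z + h₁(x,y), w + h₂(x,y), h₃(x,y), h₄(x,y))` in the coordinates
`x = X 0, y = X 1, z = X 2, w = X 3`. -/
noncomputable def tildeMap {K : Type*} [CommSemiring K]
    (h₁ h₂ h₃ h₄ : MvPolynomial (Fin 2) K) : PolyMap 4 K :=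
  ![X 2 + liftXY h₁, X 3 + liftXY h₂, liftXY h₃, liftXY h₄]

/-- First normal form: `(z + a(y), β, c(y), 0)`. -/
def IsTriangularForm {K : Type*} [Field K] (H : PolyMap 4 K) : Prop :=
  ∃ (a c : Polynomial K) (β : K),
    H = ![X 2 + Polynomial.aeval (X 1) a, C β, Polynomial.aeval (X 1) c, 0]

/-- Second normal form: `(z - 2αy·b - δy + ρ, b, αb² + δb + ε, 0)` with `b = g(x + αy²)`. -/
def IsParabolicForm {K : Type*} [Field K] (H : PolyMap 4 K) : Prop :=
  ∃ (g : Polynomial K) (b : MvPolynomial (Fin 4) K) (α δ ρ ε : K),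
    b = Polynomial.aeval (X 0 + C α * X 1 ^ 2) g ∧
    H = ![X 2 - C (2 * α) * X 1 * b - C δ * X 1 + C ρ, b,
      C α * b ^ 2 + C δ * b + C ε, 0]

end PolyMap

/-! The linear parts `z`, `w` force the dependence to involve only the last two components, so a
conjugation by `S ⊕ S` makes the last one zero (`exists_conj_tildeMap_last_eq_zero`). For `(z + P, w
+ Q, R, 0)`, nilpotency gives `P_x + Q_y = 0`, `P_x Q_y - P_y Q_x = R_x` and `R_x Q_y = R_y Q_x`.

If `Q_x = 0`, these equations give the triangular form. Otherwise `D = ∂_y - (Q_y / Q_x) ∂_x` on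
`K(x, y)` differentiates along the level curves of `Q`. The equations make `D (D x)` a constant of
`D`, so `x` is quadratic in `y` on each level curve: `x = x₀ + s₀ y - (μ/2) y²`. Since `Q` is
polynomial, comparing top coefficients shows that `μ`, and then `s₀`, is algebraic over `K`, hence
lies in `K` (`exists_pderiv_one_eq_mul_pderiv_zero`). A linear shear removes `s₀`; then `Q = g(x +
αy²)`, and `P`, `R` follow by integration (`parabolic_of_pderiv_one_eq`). -/

/-! ### Derivations of `K(x, y)` and their constants -/

open MvPolynomial in
/-- A derivation on the fraction field of a polynomial ring may be prescribed on the variables. -/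
lemma exists_derivation_fractionRing_apply_X {σ K F : Type*} [Field K] [Field F] [Algebra K F]
    [Algebra (MvPolynomial σ K) F] [IsScalarTower K (MvPolynomial σ K) F]
    [IsFractionRing (MvPolynomial σ K) F] (v : σ → F) :
    ∃ D : Derivation K F F, ∀ i, D (algebraMap (MvPolynomial σ K) F (X i)) = v i := by
  let A := MvPolynomial σ K
  -- A derivation is the second component of an algebra map into the dual numbers. It extends to
  -- fractions because units there are detected by the first component.
  let φ : A →ₐ[K] TrivSqZeroExt F F :=
    aeval fun i => TrivSqZeroExt.inl (algebraMap A F (X i)) + TrivSqZeroExt.inr (v i)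
  have hφ : ∀ a, (φ a).fst = algebraMap A F a := by
    intro a
    have h : (TrivSqZeroExt.fstHom K F F).comp φ = IsScalarTower.toAlgHom K A F := by
      ext i
      simp only [AlgHom.comp_apply, φ, aeval_X, TrivSqZeroExt.fstHom_apply, TrivSqZeroExt.fst_add,
        TrivSqZeroExt.fst_inl, TrivSqZeroExt.fst_inr, add_zero]
      rfl
    exact DFunLike.congr_fun h a
  have hu : ∀ y : nonZeroDivisors A, IsUnit (φ y) := by
    intro y
    rw [TrivSqZeroExt.isUnit_iff_isUnit_fst, hφ]
    exact IsLocalization.map_units F y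
  let ψ : F →ₐ[K] TrivSqZeroExt F F := IsLocalization.liftAlgHom (M := nonZeroDivisors A) hu
  have hψ : ∀ a, ψ (algebraMap A F a) = φ a := fun a => IsLocalization.lift_eq hu a
  have hfst : ∀ x, (ψ x).fst = x := by
    intro x
    obtain ⟨a, b, hb, rfl⟩ := IsFractionRing.div_surjective (A := A) x
    have hb0 : algebraMap A F b ≠ 0 := IsFractionRing.to_map_ne_zero_of_mem_nonZeroDivisors hb
    have h1 : (ψ (algebraMap A F a / algebraMap A F b)).fst * (ψ (algebraMap A F b)).fst =
        algebraMap A F a := by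
      rw [← TrivSqZeroExt.fst_mul, ← map_mul, div_mul_cancel₀ _ hb0, hψ, hφ]
    rw [hψ b, hφ] at h1
    exact (eq_div_iff hb0).2 h1
  refine ⟨Derivation.mk' ((TrivSqZeroExt.sndHom F F).restrictScalars K ∘ₗ ψ.toLinearMap) ?_, ?_⟩
  · intro a b
    simp [hfst, mul_comm]
  · intro i
    change (ψ (algebraMap A F (X i))).snd = v i
    have hX : φ (X i) = _ := aeval_X _ i
    rw [hψ, hX]
    simp

lemma derivation_algebraMap_eq_pderiv {K B : Type*} [Field K] [CommRing B] [Algebra K B]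
    [Algebra (MvPolynomial (Fin 2) K) B] [IsScalarTower K (MvPolynomial (Fin 2) K) B]
    (D : Derivation K B B) (p : MvPolynomial (Fin 2) K) :
    D (algebraMap _ B p) =
      algebraMap _ B (MvPolynomial.pderiv 0 p) * D (algebraMap (MvPolynomial (Fin 2) K) B (MvPolynomial.X 0)) +
      algebraMap _ B (MvPolynomial.pderiv 1 p) * D (algebraMap (MvPolynomial (Fin 2) K) B (MvPolynomial.X 1)) := by
  induction p using MvPolynomial.induction_on with
  | C a =>
    rw [← MvPolynomial.algebraMap_eq, ← IsScalarTower.algebraMap_apply]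
    simp
  | add p q hp hq => simp only [map_add, hp, hq]; ring
  | mul_X p i hp =>
    simp only [map_mul, Derivation.leibniz, hp, map_add, smul_eq_mul, MvPolynomial.pderiv_X]
    fin_cases i <;> simp <;> ring

/-- An element with derivative `1` is transcendental over the constants of a derivation. -/
lemma Polynomial.eq_zero_of_mapCoeffs_eq_zero {K F : Type*} [Field K] [Field F] [CharZero F]
    [Algebra K F] (D : Derivation K F F) {y : F} (hy : D y = 1) :
    ∀ (n : ℕ) (p : Polynomial F), p.natDegree ≤ n → D.mapCoeffs p = 0 → p.eval y = 0 → p = 0 := by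
  intro n
  have key : ∀ p : Polynomial F, p.natDegree = 0 → p.eval y = 0 → p = 0 := by
    intro p hp h
    rw [Polynomial.eq_C_of_natDegree_eq_zero hp] at h ⊢
    simpa using h
  induction n with
  | zero => exact fun p hp _ h => key p (by omega) h
  | succ n ih =>
    intro p hp hD h
    refine key p (Polynomial.derivative_eq_zero.1 (ih _ ?_ ?_ ?_)) h
    · exact (Polynomial.natDegree_derivative_le p).trans (by omega)
    · ext i
      have := congrArg (fun q => PolynomialModule.coeff q (i + 1)) hD
      simp [Polynomial.coeff_derivative] at this ⊢
      simp [this]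
    -- Differentiating `p(y) = 0` leaves `p'(y) = 0`, as the coefficients are constants and `D y =
    -- 1`.
    · have := D.apply_eval_eq y p
      simpa [h, hD, hy] using this.symm

/-- If `Q(r(T), T)` is constant in `T`, then the top coefficient of `r` is algebraic. -/
lemma isAlgebraic_coeff_of_aeval_eq_C {K F : Type*} [Field K] [Field F] [Algebra K F]
    (Q : MvPolynomial (Fin 2) K) (r : Polynomial F) {d : ℕ} (hd : r.natDegree ≤ d)
    (hd1 : 1 ≤ d) {c : F} (h : MvPolynomial.aeval ![r, Polynomial.X] Q = Polynomial.C c) :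
    IsAlgebraic K (r.coeff d) ∨ ∃ a, Q = MvPolynomial.C a := by
  classical
  -- The weight of a monomial bounds its degree in `T` after substituting `(r(T), T)`.
  let wt : (Fin 2 →₀ ℕ) → ℕ := fun m => m 0 * d + m 1
  by_cases hN : Q.support.sup wt = 0
  · right
    refine ⟨Q.coeff 0, ?_⟩
    ext m
    rw [MvPolynomial.coeff_C]
    split_ifs with hm
    · rw [hm]
    · by_contra hmQ
      have : wt m ≤ 0 := hN ▸ Finset.le_sup (MvPolynomial.mem_support_iff.2 hmQ)
      apply hm
      ext i
      simp only [wt, nonpos_iff_eq_zero, Nat.add_eq_zero_iff, mul_eq_zero] at this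
      fin_cases i <;> simp <;> omega
  · left
    set N := Q.support.sup wt with hNdef
    have hne : Q.support.Nonempty := by
      rw [Finset.nonempty_iff_ne_empty]
      rintro he
      exact hN (by rw [hNdef, he]; simp)
    obtain ⟨m, hmQ, hm⟩ := Finset.exists_mem_eq_sup Q.support hne wt
    -- The top weighted part of `Q` at `(X, 1)`. It is nonzero because weight and `m 0` determine
    -- `m`; its value at `r.coeff d` is the coefficient of `T ^ N`, which vanishes since `N > 0`.
    let g : Polynomial K :=
      ∑ m ∈ Q.support with wt m = N, Polynomial.C (Q.coeff m) * Polynomial.X ^ m 0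
    refine ⟨g, ?_, ?_⟩
    · intro hg
      have h1 : g.coeff (m 0) = Q.coeff m := by
        simp only [g, Polynomial.finsetSum_coeff, Polynomial.coeff_C_mul_X_pow]
        rw [Finset.sum_eq_single m]
        · simp
        · intro b hb hbm
          rw [if_neg]
          intro h0
          apply hbm
          have hb' : wt b = N := (Finset.mem_filter.1 hb).2
          have hm' : wt m = N := hm.symm
          simp only [wt] at hb' hm'
          ext i
          rw [h0] at hm'
          fin_cases i <;> simp <;> omega
        · intro hm'
          exact absurd (Finset.mem_filter.2 ⟨hmQ, hm.symm⟩) hm'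
      rw [hg] at h1
      exact MvPolynomial.mem_support_iff.1 hmQ (by simpa using h1.symm)
    · have h2 := congrArg (fun q => Polynomial.coeff q N) h
      simp only [Polynomial.coeff_C, if_neg hN] at h2
      rw [MvPolynomial.aeval_def, MvPolynomial.eval₂_eq', Polynomial.finsetSum_coeff] at h2
      rw [← h2]
      simp only [g, map_sum, map_mul, map_pow, Polynomial.aeval_X, Polynomial.aeval_C]
      rw [Finset.sum_filter]
      refine Finset.sum_congr rfl fun b hb => ?_
      have hbN : wt b ≤ N := Finset.le_sup hb
      rw [Polynomial.algebraMap_apply, Polynomial.coeff_C_mul, Fin.prod_univ_two]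
      simp only [Matrix.cons_val_zero, Matrix.cons_val_one, Polynomial.coeff_mul_X_pow']
      have hdeg : (r ^ b 0).natDegree ≤ b 0 * d :=
        Polynomial.natDegree_pow_le_of_le _ hd
      simp only [wt] at hbN ⊢
      split_ifs with h3 h4 h4
      · rw [← h3, Nat.add_sub_cancel, Polynomial.coeff_pow_of_natDegree_le hd]
      · omega
      · rw [Polynomial.coeff_eq_zero_of_natDegree_lt (by omega), mul_zero]
      · simp

/-! ### `K` is algebraically closed in its rational function field -/

lemma MvPolynomial.eq_C_of_pderiv_eq_zero {σ K : Type*} [Field K] [CharZero K]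
    {p : MvPolynomial σ K} (h : ∀ i, pderiv i p = 0) : p = C (p.coeff 0) := by
  classical
  ext m
  rw [coeff_C]
  split_ifs with hm
  · rw [hm]
  · obtain ⟨i, hi⟩ : ∃ i, m i ≠ 0 := by
      by_contra! hc
      exact hm (Finsupp.ext fun i => (hc i).symm)
    have h1 := coeff_pderiv (i := i) p (m - Finsupp.single i 1)
    rw [h i, coeff_zero, tsub_add_cancel_of_le (by simpa [Nat.one_le_iff_ne_zero] using hi)] at h1
    exact (mul_eq_zero.1 h1.symm).resolve_right (Nat.cast_add_one_ne_zero _)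

/-- Differentiating the minimal polynomial relation kills every partial derivative of `p`, because
the derivative of the minimal polynomial is nonzero at `p`. -/
lemma MvPolynomial.eq_C_of_isAlgebraic {σ K : Type*} [Field K] [CharZero K]
    {p : MvPolynomial σ K} (h : IsAlgebraic K p) : ∃ a, p = C a := by
  refine ⟨_, eq_C_of_pderiv_eq_zero fun i => ?_⟩
  have hint : IsIntegral K p := h.isIntegral
  have h1 := (pderiv i).map_aeval (minpoly K p) p
  rw [minpoly.aeval, map_zero, smul_eq_mul, eq_comm, mul_eq_zero] at h1
  refine h1.resolve_left fun h2 => ?_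
  have h3 := minpoly.degree_le_of_ne_zero K p (p := Polynomial.derivative (minpoly K p)) ?_ h2
  · exact (Polynomial.degree_derivative_lt (minpoly.ne_zero hint)).not_ge h3
  · intro h4
    exact (minpoly.natDegree_pos hint).ne' (Polynomial.derivative_eq_zero.1 h4)

lemma exists_algebraMap_eq_of_isAlgebraic_fractionRing {σ K F : Type*} [Field K] [CharZero K]
    [Field F] [Algebra K F] [Algebra (MvPolynomial σ K) F]
    [IsScalarTower K (MvPolynomial σ K) F] [IsFractionRing (MvPolynomial σ K) F]
    {f : F} (h : IsAlgebraic K f) :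
    ∃ a : K, f = algebraMap (MvPolynomial σ K) F (MvPolynomial.C a) := by
  have hint : IsIntegral (MvPolynomial σ K) f := h.isIntegral.tower_top
  obtain ⟨p, rfl⟩ := IsIntegrallyClosed.isIntegral_iff.1 hint
  rw [isAlgebraic_algebraMap_iff (IsFractionRing.injective _ _)] at h
  obtain ⟨a, rfl⟩ := MvPolynomial.eq_C_of_isAlgebraic h
  exact ⟨a, rfl⟩

/-! ### The level curves of `Q` -/

namespace MvPolynomial

lemma pderiv_pderiv_comm {σ R : Type*} [CommSemiring R] (i j : σ) (p : MvPolynomial σ R) :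
    pderiv i (pderiv j p) = pderiv j (pderiv i p) := by
  classical
  ext m
  simp only [coeff_pderiv, Finsupp.add_apply, Finsupp.single_apply]
  rw [add_right_comm]
  rcases eq_or_ne i j with rfl | h
  · rfl
  · simp [h, h.symm, mul_assoc, mul_comm, mul_left_comm]

lemma aeval_parabolic_shear {K : Type*} [CommRing K] (β : K) (p : MvPolynomial (Fin 2) K) :
    aeval ![X 0 - C β * X 1 ^ 2, X 1] (aeval ![X 0 + C β * X 1 ^ 2, X 1] p) = p := by
  rw [← AlgHom.comp_apply]
  conv_rhs => rw [← AlgHom.id_apply (R := K) p]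
  congr 1
  apply algHom_ext
  intro i
  fin_cases i <;> simp

/-- The level curves of `Q` are translates of one parabola when `(z + P, Q, R)` has
nilpotent Jacobian. -/
lemma exists_pderiv_one_eq_mul_pderiv_zero_of_isFractionRing {K : Type*} (F : Type*) [Field K]
    [CharZero K] [Field F] [Algebra K F] [Algebra (MvPolynomial (Fin 2) K) F]
    [IsScalarTower K (MvPolynomial (Fin 2) K) F] [IsFractionRing (MvPolynomial (Fin 2) K) F]
    {P Q R : MvPolynomial (Fin 2) K} (h1 : pderiv 0 P + pderiv 1 Q = 0)
    (h2 : pderiv 0 P * pderiv 1 Q - pderiv 1 P * pderiv 0 Q = pderiv 0 R)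
    (h3 : pderiv 0 R * pderiv 1 Q = pderiv 1 R * pderiv 0 Q) (hQ : pderiv 0 Q ≠ 0) :
    ∃ α τ : K, pderiv 1 Q = (C (2 * α) * X 1 - C τ) * pderiv 0 Q := by
  have : CharZero F := charZero_of_injective_algebraMap (algebraMap K F).injective
  let ι : MvPolynomial (Fin 2) K →ₐ[K] F := IsScalarTower.toAlgHom K (MvPolynomial (Fin 2) K) F
  have hι : ∀ a, algebraMap (MvPolynomial (Fin 2) K) F a = ι a := fun _ => rfl
  have ιinj : Function.Injective ι := IsFractionRing.injective (MvPolynomial (Fin 2) K) F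
  -- Heuristically `R = f(Q)` by `h3`, and then `N = f''(Q) Q_x³`. So `N / Q_x³` should be constant
  -- along level curves (`hND`), while `hNs` identifies it with `-d²x/dy²` there.
  set N : MvPolynomial (Fin 2) K := pderiv 0 (pderiv 0 R) * pderiv 0 Q - pderiv 0 R * pderiv 0 (pderiv 0 Q) with hN
  have hq : ι (pderiv 0 Q) ≠ 0 := by
    rwa [Ne, map_eq_zero_iff ι ιinj]
  -- polynomial identities
  have cQ := pderiv_pderiv_comm 1 0 Q
  have cP := pderiv_pderiv_comm 1 0 P
  have cR := pderiv_pderiv_comm 1 0 R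
  have cQ' := congrArg (pderiv 0) cQ
  have cR' := congrArg (pderiv 0) cR
  have cQ'' := pderiv_pderiv_comm 1 0 (pderiv 0 Q)
  have cR'' := pderiv_pderiv_comm 1 0 (pderiv 0 R)
  have h1y := congrArg (pderiv 1) h1
  have h1x := congrArg (pderiv 0) h1
  have h2x := congrArg (pderiv 0) h2
  have h3x := congrArg (pderiv 0) h3
  have h3xx := congrArg (pderiv 0) h3x
  simp only [map_add, map_sub, map_zero, Derivation.leibniz, smul_eq_mul] at h1y h1x h2x h3x h3xx
  rw [cQ'] at cQ''
  rw [cR'] at cR''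
  rw [cP] at h1y
  have hNs : N = pderiv 1 (pderiv 1 Q) * pderiv 0 Q ^ 2
      - 2 * pderiv 0 Q * pderiv 1 Q * pderiv 0 (pderiv 1 Q)
      + pderiv 1 Q ^ 2 * pderiv 0 (pderiv 0 Q) := by
    rw [hN]
    linear_combination -pderiv 0 Q * h2x + pderiv 0 (pderiv 0 Q) * h2 +
      (pderiv 0 Q * pderiv 0 (pderiv 1 Q) - pderiv 0 (pderiv 0 Q) * pderiv 1 Q) * h1 +
      pderiv 0 Q * pderiv 1 Q * h1x - pderiv 0 Q ^ 2 * h1y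
  have hND : (pderiv 1 N * pderiv 0 Q - pderiv 0 N * pderiv 1 Q) * pderiv 0 Q =
      3 * N * (pderiv 0 (pderiv 1 Q) * pderiv 0 Q - pderiv 0 (pderiv 0 Q) * pderiv 1 Q) := by
    rw [hN]
    simp only [map_sub, Derivation.leibniz, smul_eq_mul]
    rw [cQ, cR, cQ'', cR'']
    linear_combination -pderiv 0 Q ^ 2 * h3xx + 3 * pderiv 0 Q * pderiv 0 (pderiv 0 Q) * h3x +
      (pderiv 0 Q * pderiv 0 (pderiv 0 (pderiv 0 Q)) - 3 * pderiv 0 (pderiv 0 Q) ^ 2) * h3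
  obtain ⟨D, hD⟩ : ∃ D : Derivation K F F, ∀ i : Fin 2, D (ι (X i)) =
      ![-ι (pderiv 1 Q) / ι (pderiv 0 Q), 1] i := exists_derivation_fractionRing_apply_X
    ![-ι (pderiv 1 Q) / ι (pderiv 0 Q), (1 : F)]
  have hx : D (ι (X 0)) = -ι (pderiv 1 Q) / ι (pderiv 0 Q) := hD 0
  have hy : D (ι (X 1)) = 1 := hD 1
  have hDι : ∀ p : MvPolynomial (Fin 2) K, D (ι p) =
      (ι (pderiv 1 p) * ι (pderiv 0 Q) - ι (pderiv 0 p) * ι (pderiv 1 Q)) / ι (pderiv 0 Q) := by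
    intro p
    have : D (ι p) = ι (pderiv 0 p) * D (ι (X 0)) + ι (pderiv 1 p) * D (ι (X 1)) :=
      derivation_algebraMap_eq_pderiv D p
    rw [this, hx, hy]
    field_simp
    ring
  have hDQ : D (ι Q) = 0 := by
    rw [hDι]
    simp [mul_comm]
  set s : F := -ι (pderiv 1 Q) / ι (pderiv 0 Q) with hs
  set μ : F := ι N / ι (pderiv 0 Q) ^ 3 with hμ
  have hDs : D s = -μ := by
    rw [hs, Derivation.leibniz_div, map_neg, hDι, hDι, hμ, hNs, cQ]
    simp only [map_sub, map_add, map_mul, map_pow, map_ofNat, smul_eq_mul]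
    field_simp
    ring
  have hDμ : D μ = 0 := by
    have := congrArg ι hND
    simp only [map_sub, map_mul, map_ofNat] at this
    rw [hμ, Derivation.leibniz_div, Derivation.leibniz_pow, hDι, hDι, cQ]
    simp only [smul_eq_mul, nsmul_eq_mul]
    field_simp
    push_cast
    linear_combination ι (pderiv 0 Q) ^ 2 * this
  have h2F : D (2 : F) = 0 := D.map_natCast 2
  -- Integrating `D s = -μ` and `D x = s` from `y = 0` gives the constants `s₀` and `x₀`.
  set s₀ : F := s + μ * ι (X 1) with hs₀
  have hDs₀ : D s₀ = 0 := by
    simp [hs₀, hDs, hDμ, hy]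
  set x₀ : F := ι (X 0) - s₀ * ι (X 1) + μ / 2 * ι (X 1) ^ 2 with hx₀
  have hDμ2 : D (μ / 2) = 0 := by
    simp [Derivation.leibniz_div, hDμ, h2F]
  have hDx₀ : D x₀ = 0 := by
    simp only [hx₀, map_add, map_sub, Derivation.leibniz, Derivation.leibniz_pow, hx, hy, hDs₀,
      hDμ2, smul_eq_mul, nsmul_eq_mul]
    rw [hs₀]
    field_simp
    push_cast
    ring
  let r : Polynomial F := Polynomial.C x₀ + Polynomial.C s₀ * Polynomial.X
    - Polynomial.C (μ / 2) * Polynomial.X ^ 2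
  -- The polynomial `r` parametrizes the level curve by `y`. Since `Q(r(T), T) - Q` has constant
  -- coefficients and vanishes at `T = y`, it vanishes identically.
  have hr : D.mapCoeffs r = 0 := by
    simp [r, Derivation.leibniz_pow, hDx₀, hDs₀, hDμ2, PolynomialModule.single]
  have hconst : aeval ![r, Polynomial.X] Q = Polynomial.C (ι Q) := by
    rw [← sub_eq_zero]
    refine Polynomial.eq_zero_of_mapCoeffs_eq_zero D hy _ _ le_rfl ?_ ?_
    · have h0 : ∀ p : MvPolynomial (Fin 2) K, D.mapCoeffs (aeval ![r, Polynomial.X] p) = 0 := by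
        intro p
        induction p using MvPolynomial.induction_on with
        | C a =>
          rw [aeval_C, Polynomial.algebraMap_apply, Derivation.mapCoeffs_C, Derivation.map_algebraMap]
          simp [PolynomialModule.single]
        | add p q hp hq => rw [map_add, map_add, hp, hq, add_zero]
        | mul_X p i hp =>
          rw [map_mul, Derivation.leibniz, hp, aeval_X]
          fin_cases i <;> simp [hr]
      rw [map_sub, h0, Derivation.mapCoeffs_C, hDQ]
      simp [PolynomialModule.single]
    · have : ((Polynomial.aeval (R := F) (ι (X 1))).restrictScalars K).comp
          (aeval ![r, Polynomial.X]) = ι := by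
        ext i
        fin_cases i
        · simp [r, hx₀]
          ring
        · simp
      have h4 := DFunLike.congr_fun this Q
      simp at h4
      simp [h4]
  have hnc : ¬ ∃ a, Q = C a := by
    rintro ⟨a, rfl⟩
    simp at hQ
  have hμalg : IsAlgebraic K (r.coeff 2) := by
    refine (isAlgebraic_coeff_of_aeval_eq_C Q r ?_ (by norm_num) hconst).resolve_right hnc
    simp only [r]
    compute_degree
  obtain ⟨β, hβ⟩ := exists_algebraMap_eq_of_isAlgebraic_fractionRing (σ := Fin 2) hμalg
  have hβ' : μ = -2 * ι (C β) := by
    rw [← hι, ← hβ]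
    simp only [r, Polynomial.coeff_sub, Polynomial.coeff_add, Polynomial.coeff_C_mul,
      Polynomial.coeff_X_pow, Polynomial.coeff_X, Polynomial.coeff_C]
    norm_num
    ring
  -- Once the quadratic coefficient is known to be `β ∈ K`, a shear over `K` absorbs it, and the
  -- degree argument applies again to the linear coefficient.
  let r' : Polynomial F := Polynomial.C x₀ + Polynomial.C s₀ * Polynomial.X
  let φ : MvPolynomial (Fin 2) K →ₐ[K] (MvPolynomial (Fin 2) K) := aeval ![X 0 + C β * X 1 ^ 2, X 1]
  have hconst' : aeval ![r', Polynomial.X] (φ Q) = Polynomial.C (ι Q) := by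
    rw [← hconst]
    have : (aeval (R := K) ![r', Polynomial.X]).comp φ = aeval ![r, Polynomial.X] := by
      ext i
      fin_cases i
      · have : μ / 2 = -ι (C β) := by rw [hβ']; ring
        simp only [φ, r', r, this, map_neg]
        simp [Polynomial.algebraMap_apply]
      · simp [φ]
    exact DFunLike.congr_fun this Q
  have hsalg : IsAlgebraic K (r'.coeff 1) := by
    refine (isAlgebraic_coeff_of_aeval_eq_C (φ Q) r' ?_ le_rfl hconst').resolve_right ?_
    · simp only [r']
      compute_degree
    · rintro ⟨a, ha⟩
      refine hnc ⟨a, ?_⟩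
      have := aeval_parabolic_shear β Q
      change aeval _ (φ Q) = Q at this
      rw [← this, ha]
      exact aeval_C _ a
  obtain ⟨τ, hτ⟩ := exists_algebraMap_eq_of_isAlgebraic_fractionRing (σ := Fin 2) hsalg
  have hτ' : s₀ = ι (C τ) := by
    rw [← hι, ← hτ]
    simp [r', Polynomial.coeff_C]
  refine ⟨-β, τ, ιinj ?_⟩
  have hfin : -ι (pderiv 1 Q) = (ι (C τ) + 2 * ι (C β) * ι (X 1)) * ι (pderiv 0 Q) := by
    rw [← div_eq_iff hq, ← hs, ← hτ', hs₀, hβ']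
    ring
  simp only [map_mul, map_sub, map_neg, map_ofNat]
  linear_combination -hfin

lemma exists_pderiv_one_eq_mul_pderiv_zero {K : Type*} [Field K] [CharZero K]
    {P Q R : MvPolynomial (Fin 2) K} (h1 : pderiv 0 P + pderiv 1 Q = 0)
    (h2 : pderiv 0 P * pderiv 1 Q - pderiv 1 P * pderiv 0 Q = pderiv 0 R)
    (h3 : pderiv 0 R * pderiv 1 Q = pderiv 1 R * pderiv 0 Q) (hQ : pderiv 0 Q ≠ 0) :
    ∃ α τ : K, pderiv 1 Q = (C (2 * α) * X 1 - C τ) * pderiv 0 Q :=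
  exists_pderiv_one_eq_mul_pderiv_zero_of_isFractionRing
    (FractionRing (MvPolynomial (Fin 2) K)) h1 h2 h3 hQ

end MvPolynomial

/-! ### Solving the differential equations -/

namespace MvPolynomial

lemma exists_eq_aeval_X_of_pderiv_eq_zero {σ K : Type*} [Field K] [CharZero K] (i : σ)
    {p : MvPolynomial σ K} (h : ∀ j, j ≠ i → pderiv j p = 0) :
    ∃ g : Polynomial K, p = Polynomial.aeval (X i) g := by
  classical
  refine ⟨∑ m ∈ p.support, Polynomial.C (p.coeff m) * Polynomial.X ^ m i, ?_⟩
  rw [map_sum]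
  conv_lhs => rw [p.as_sum]
  refine Finset.sum_congr rfl fun m hm => ?_
  have hm' : m = Finsupp.single i (m i) := by
    ext j
    rcases eq_or_ne j i with rfl | hj
    · simp
    · rw [Finsupp.single_eq_of_ne hj]
      by_contra hmj
      have h1 := coeff_pderiv (i := j) p (m - Finsupp.single j 1)
      rw [h j hj, coeff_zero,
        tsub_add_cancel_of_le (by simpa [Nat.one_le_iff_ne_zero] using hmj)] at h1
      exact mem_support_iff.1 hm
        ((mul_eq_zero.1 h1.symm).resolve_right (Nat.cast_add_one_ne_zero _))
  rw [map_mul, map_pow, Polynomial.aeval_X, Polynomial.aeval_C, algebraMap_eq]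
  conv_lhs => rw [hm']
  rw [C_mul_X_pow_eq_monomial, ← hm']

lemma triangular_of_pderiv_zero_eq_zero {K : Type*} [Field K] [CharZero K]
    {P Q R : MvPolynomial (Fin 2) K} (h1 : pderiv 0 P + pderiv 1 Q = 0)
    (h2 : pderiv 0 P * pderiv 1 Q - pderiv 1 P * pderiv 0 Q = pderiv 0 R)
    (h3 : pderiv 0 R * pderiv 1 Q = pderiv 1 R * pderiv 0 Q) (hQ : pderiv 0 Q = 0) :
    ∃ (a c : Polynomial K) (β : K), P = Polynomial.aeval (X 1) a ∧ Q = C β ∧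
      R = Polynomial.aeval (X 1) c := by
  have hQy : pderiv 1 Q = 0 := by
    -- With `Q_x = 0`, the equations give `R_x = -Q_y²` and `R_x Q_y = 0`.
    rw [← pow_eq_zero_iff (n := 3) (by norm_num)]
    linear_combination pderiv 1 Q ^ 2 * h1 - pderiv 1 Q * h2 - h3
      - (pderiv 1 P * pderiv 1 Q + pderiv 1 R) * hQ
  have hP : pderiv 0 P = 0 := by simpa [hQy] using h1
  have hR : pderiv 0 R = 0 := by simpa [hQy, hQ] using h2.symm
  have aux : ∀ p : MvPolynomial (Fin 2) K, pderiv 0 p = 0 → ∀ j, j ≠ 1 → pderiv j p = 0 := by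
    intro p hp j hj
    fin_cases j
    · exact hp
    · exact absurd rfl hj
  obtain ⟨a, ha⟩ := exists_eq_aeval_X_of_pderiv_eq_zero 1 (aux P hP)
  obtain ⟨c, hc⟩ := exists_eq_aeval_X_of_pderiv_eq_zero 1 (aux R hR)
  exact ⟨a, c, _, ha, eq_C_of_pderiv_eq_zero (Fin.forall_fin_two.2 ⟨hQ, hQy⟩), hc⟩

lemma pderiv_aeval {σ τ R : Type*} [Fintype σ] [CommRing R] (G : σ → MvPolynomial τ R) (k : τ)
    (p : MvPolynomial σ R) :
    pderiv k (aeval G p) = ∑ l, aeval G (pderiv l p) * pderiv k (G l) := by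
  classical
  induction p using MvPolynomial.induction_on with
  | C a => simp [← algebraMap_eq]
  | add p q hp hq => simp only [map_add, hp, hq, add_mul, Finset.sum_add_distrib]
  | mul_X p i hp =>
    simp only [map_mul, Derivation.leibniz, hp, map_add, smul_eq_mul, aeval_X, pderiv_X, add_mul,
      Finset.sum_add_distrib, Finset.mul_sum]
    congr 1
    · rw [Finset.sum_eq_single i]
      · simp
      · intro j _ hj
        simp [hj.symm]
      · simp
    · exact Finset.sum_congr rfl fun j _ => by ring

/-- The substitution `x ↦ x - αy²` straightens the parabolas, after which `Q` no longer depends on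
`y`. -/
lemma exists_eq_aeval_parabola {K : Type*} [Field K] [CharZero K] {α : K}
    {Q : MvPolynomial (Fin 2) K} (hQ : pderiv 1 Q = C (2 * α) * X 1 * pderiv 0 Q) :
    ∃ g : Polynomial K, Q = Polynomial.aeval (X 0 + C α * X 1 ^ 2) g := by
  have h2 : (C (2 : K) : MvPolynomial (Fin 2) K) = 2 := map_ofNat C 2
  have h0 : pderiv (1 : Fin 2) (aeval ![X 0 - C α * X 1 ^ 2, X 1] Q) = 0 := by
    rw [pderiv_aeval, Fin.sum_univ_two, hQ]
    rw [C_mul, h2]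
    simp only [map_mul, map_ofNat]
    simp [algebraMap_eq]
    ring
  have h1 : ∀ j : Fin 2, j ≠ 0 → pderiv j (aeval ![X 0 - C α * X 1 ^ 2, X 1] Q) = 0 := by
    intro j hj
    obtain rfl : j = 1 := by omega
    exact h0
  obtain ⟨g, hg⟩ := exists_eq_aeval_X_of_pderiv_eq_zero 0 h1
  refine ⟨g, ?_⟩
  have := aeval_parabolic_shear (-α) Q
  rw [C_neg, neg_mul, ← sub_eq_add_neg, sub_neg_eq_add, hg, ← Polynomial.aeval_algHom_apply,
    aeval_X] at this
  rw [← this]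
  simp

lemma parabolic_of_pderiv_one_eq {K : Type*} [Field K] [CharZero K] {α : K}
    {P Q R : MvPolynomial (Fin 2) K} (h1 : pderiv 0 P + pderiv 1 Q = 0)
    (h2 : pderiv 0 P * pderiv 1 Q - pderiv 1 P * pderiv 0 Q = pderiv 0 R)
    (h3 : pderiv 0 R * pderiv 1 Q = pderiv 1 R * pderiv 0 Q) (hQ0 : pderiv 0 Q ≠ 0)
    (hQ : pderiv 1 Q = C (2 * α) * X 1 * pderiv 0 Q) :
    ∃ (g : Polynomial K) (δ ρ ε : K), Q = Polynomial.aeval (X 0 + C α * X 1 ^ 2) g ∧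
      P = -C (2 * α) * X 1 * Q - C δ * X 1 + C ρ ∧ R = C α * Q ^ 2 + C δ * Q + C ε := by
  obtain ⟨g, hg⟩ := exists_eq_aeval_parabola hQ
  have hR : pderiv 1 R = C (2 * α) * X 1 * pderiv 0 R := by
    refine mul_right_cancel₀ hQ0 ?_
    rw [← h3, hQ]
    ring
  have d01 : pderiv 0 (X 1 : MvPolynomial (Fin 2) K) = 0 := pderiv_X_of_ne (by decide)
  have d11 : pderiv 1 (X 1 : MvPolynomial (Fin 2) K) = 1 := pderiv_X_self 1
  -- This `W` should be `-δy + ρ`.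
  obtain ⟨W, hW⟩ : ∃ W, W = P + C (2 * α) * X 1 * Q := ⟨_, rfl⟩
  have hWx : pderiv 0 W = 0 := by
    rw [hW]
    simp only [map_add, Derivation.leibniz, d01, pderiv_C, smul_eq_mul]
    linear_combination h1 - hQ
  have hWy : pderiv 1 W * pderiv 0 Q = C (2 * α) * Q * pderiv 0 Q - pderiv 0 R := by
    rw [hW]
    simp only [map_add, Derivation.leibniz, d11, pderiv_C, smul_eq_mul]
    linear_combination pderiv 1 Q * h1 - h2 - pderiv 1 Q * hQ
  -- The derivation `∂_y - 2αy ∂_x` kills `Q` and `R` and commutes with `∂_x`, so applying it to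
  -- `hWy` leaves `W_yy Q_x = 0`.
  have hWyy : pderiv 1 (pderiv 1 W) = 0 := by
    have e1 := congrArg (pderiv 1) hWy
    have e0 := congrArg (pderiv 0) hWy
    have eQ := congrArg (pderiv 0) hQ
    have eR := congrArg (pderiv 0) hR
    have eW := congrArg (pderiv 1) hWx
    rw [pderiv_pderiv_comm, map_zero] at eW
    simp only [map_sub, Derivation.leibniz, d01, pderiv_C, smul_eq_mul] at e1 e0 eQ eR
    rw [pderiv_pderiv_comm 1 0 Q, pderiv_pderiv_comm 1 0 R] at e1
    rw [eW] at e0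
    refine (mul_eq_zero.1 ?_).resolve_right hQ0
    linear_combination e1 - C (2 * α) * X 1 * e0
      - (pderiv 1 W - C (2 * α) * Q) * eQ - eR + C (2 * α) * pderiv 0 Q * hQ
  have hWyx : pderiv 0 (pderiv 1 W) = 0 := by rw [pderiv_pderiv_comm, hWx, map_zero]
  obtain ⟨δ, hδ⟩ : ∃ δ, pderiv 1 W = -C δ := ⟨-_, by
    rw [C_neg, neg_neg]
    exact eq_C_of_pderiv_eq_zero (Fin.forall_fin_two.2 ⟨hWyx, hWyy⟩)⟩
  have hρ := eq_C_of_pderiv_eq_zero (p := W + C δ * X 1) (Fin.forall_fin_two.2 ⟨by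
    simp [hWx, d01], by simp [hδ]⟩)
  have hRx : pderiv 0 R = C (2 * α) * Q * pderiv 0 Q + C δ * pderiv 0 Q := by
    rw [hδ] at hWy
    linear_combination hWy
  have hε := eq_C_of_pderiv_eq_zero (p := R - (C α * Q ^ 2 + C δ * Q))
    (Fin.forall_fin_two.2 ⟨by
      simp only [map_sub, map_add, pderiv_C_mul, pderiv_pow, hRx, C_mul]
      push_cast
      simp only [map_ofNat]
      ring, by
      simp only [map_sub, map_add, pderiv_C_mul, pderiv_pow, hR, hRx, hQ, C_mul]
      push_cast
      simp only [map_ofNat]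
      ring⟩)
  refine ⟨g, δ, coeff 0 (W + C δ * X 1), coeff 0 (R - (C α * Q ^ 2 + C δ * Q)), hg, ?_, ?_⟩
  · rw [← hρ, hW]
    ring
  · rw [← hε]
    ring

end MvPolynomial

/-! ### Linear conjugation and reduction to three components -/

namespace PolyMap
open MvPolynomial

lemma aeval_ofMatrix_aeval_ofMatrix {n : ℕ} {K : Type*} [CommRing K]
    (S T : Matrix (Fin n) (Fin n) K) (p : MvPolynomial (Fin n) K) :
    aeval (ofMatrix T) (aeval (ofMatrix S) p) = aeval (ofMatrix (S * T)) p := by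
  rw [← AlgHom.comp_apply]
  congr 1
  apply algHom_ext
  intro i
  simp only [AlgHom.comp_apply, aeval_X, ofMatrix, map_sum, map_mul, Matrix.mul_apply,
    Finset.sum_mul, Finset.mul_sum, algHom_C, algebraMap_eq]
  rw [Finset.sum_comm]
  simp only [mul_assoc]

lemma ofMatrix_one {n : ℕ} {K : Type*} [CommRing K] :
    ofMatrix (1 : Matrix (Fin n) (Fin n) K) = X := by
  ext1 i
  simp only [ofMatrix]
  rw [Finset.sum_eq_single i]
  · simp
  · intro j _ hj
    simp [Matrix.one_apply_ne hj.symm]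
  · simp

lemma conj_apply {n : ℕ} {K : Type*} [Field K] (T : GL (Fin n) K) (F : PolyMap n K) (i : Fin n) :
    conj T F i = ∑ j, C ((T⁻¹ : GL (Fin n) K).1 i j) * aeval (ofMatrix T.1) (F j) := by
  simp [conj, comp, ofMatrix, algebraMap_eq]

lemma conj_mul {n : ℕ} {K : Type*} [Field K] (S T : GL (Fin n) K) (F : PolyMap n K) :
    conj (S * T) F = conj T (conj S F) := by
  ext1 i
  simp only [conj_apply, map_sum, map_mul, aeval_ofMatrix_aeval_ofMatrix, mul_inv_rev,
    Units.val_mul, Matrix.mul_apply, Finset.sum_mul, Finset.mul_sum, algHom_C, algebraMap_eq]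
  rw [Finset.sum_comm]
  simp only [mul_assoc]

lemma isNilpotent_jacobian_conj {n : ℕ} {K : Type*} [Field K] (T : GL (Fin n) K)
    {F : PolyMap n K} (h : IsNilpotent F.jacobian) : IsNilpotent (conj T F).jacobian := by
  let c : Matrix (Fin n) (Fin n) K →+* Matrix (Fin n) (Fin n) (MvPolynomial (Fin n) K) :=
    (C : K →+* MvPolynomial (Fin n) K).mapMatrix
  let φ : MvPolynomial (Fin n) K →ₐ[K] MvPolynomial (Fin n) K := aeval (ofMatrix T.1)
  have key : (conj T F).jacobian = c (T⁻¹).1 * φ.toRingHom.mapMatrix F.jacobian * c T.1 := by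
    ext1 i k
    have hd : ∀ l, pderiv k (ofMatrix T.1 l) = C (T.1 l k) := by
      intro l
      simp only [ofMatrix, map_sum, pderiv_C_mul, pderiv_X]
      rw [Finset.sum_eq_single k]
      · simp
      · intro j _ hj
        simp [hj]
      · simp
    simp only [jacobian, Matrix.of_apply, conj_apply, map_sum, pderiv_C_mul, pderiv_aeval, hd,
      Matrix.mul_apply, Finset.mul_sum, Finset.sum_mul]
    rw [Finset.sum_comm]
    refine Finset.sum_congr rfl fun l _ => Finset.sum_congr rfl fun j _ => ?_
    simp [c, φ, mul_assoc]
  have hinv : c T.1 * c (T⁻¹).1 = 1 := by rw [← map_mul, Units.mul_inv, map_one]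
  obtain ⟨m, hm⟩ := h.map φ.toRingHom.mapMatrix
  refine ⟨m + 1, ?_⟩
  have hp : ∀ (a b x : Matrix (Fin n) (Fin n) (MvPolynomial (Fin n) K)), b * a = 1 →
      ∀ k : ℕ, (a * x * b) ^ (k + 1) = a * x ^ (k + 1) * b := by
    intro a b x hab k
    induction k with
    | zero => simp
    | succ k ih =>
      rw [pow_succ, ih, pow_succ x (k + 1)]
      calc a * x ^ (k + 1) * b * (a * x * b) = a * x ^ (k + 1) * (b * a) * x * b := by
            simp only [mul_assoc]
        _ = _ := by rw [hab]; simp only [mul_assoc, mul_one]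
  rw [key, hp _ _ _ hinv, pow_succ, hm]
  simp

/-- The matrix `S ⊕ S`, acting in the same way on `(x, y)` and on `(z, w)`. -/
def diagTwice {K : Type*} [CommRing K] (S : Matrix (Fin 2) (Fin 2) K) : Matrix (Fin 4) (Fin 4) K :=
  !![S 0 0, S 0 1, 0, 0; S 1 0, S 1 1, 0, 0; 0, 0, S 0 0, S 0 1; 0, 0, S 1 0, S 1 1]

lemma diagTwice_mul_eq_one {K : Type*} [CommRing K] {S S' : Matrix (Fin 2) (Fin 2) K}
    (h : S * S' = 1) : diagTwice S * diagTwice S' = 1 := by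
  have e : ∀ i j, S i 0 * S' 0 j + S i 1 * S' 1 j = (1 : Matrix (Fin 2) (Fin 2) K) i j := by
    intro i j
    rw [← h, Matrix.mul_apply, Fin.sum_univ_two]
  ext i j
  rw [Matrix.mul_apply, Fin.sum_univ_four]
  have e00 := e 0 0
  have e01 := e 0 1
  have e10 := e 1 0
  have e11 := e 1 1
  simp at e00 e01 e10 e11
  fin_cases i <;> fin_cases j <;> simp [diagTwice, e00, e01, e10, e11]

/-- The invertible matrix `S ⊕ S`, given an inverse `S'` of `S`. -/
def diagTwiceGL {K : Type*} [Field K] (S S' : Matrix (Fin 2) (Fin 2) K) (h : S * S' = 1) :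
    GL (Fin 4) K where
  val := diagTwice S
  inv := diagTwice S'
  val_inv := diagTwice_mul_eq_one h
  inv_val := diagTwice_mul_eq_one (mul_eq_one_comm.1 h)

lemma aeval_diagTwice_liftXY {K : Type*} [Field K] (S : Matrix (Fin 2) (Fin 2) K)
    (p : MvPolynomial (Fin 2) K) :
    aeval (ofMatrix (diagTwice S)) (liftXY p) = liftXY (aeval (ofMatrix S) p) := by
  unfold liftXY
  rw [aeval_rename, ← AlgHom.comp_apply]
  congr 1
  apply algHom_ext
  intro i
  fin_cases i <;> simp [ofMatrix, diagTwice, Fin.sum_univ_four, Fin.sum_univ_two]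

/-- Using the same `S` on `(x, y)` and `(z, w)` makes the linear part `(z, w)` survive, since `S' S
= 1`. -/
lemma conj_tildeMap {K : Type*} [Field K] (S S' : Matrix (Fin 2) (Fin 2) K) (h : S * S' = 1)
    (h₁ h₂ h₃ h₄ : MvPolynomial (Fin 2) K) :
    conj (diagTwiceGL S S' h) (tildeMap h₁ h₂ h₃ h₄) =
      tildeMap
        (C (S' 0 0) * aeval (ofMatrix S) h₁ + C (S' 0 1) * aeval (ofMatrix S) h₂)
        (C (S' 1 0) * aeval (ofMatrix S) h₁ + C (S' 1 1) * aeval (ofMatrix S) h₂)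
        (C (S' 0 0) * aeval (ofMatrix S) h₃ + C (S' 0 1) * aeval (ofMatrix S) h₄)
        (C (S' 1 0) * aeval (ofMatrix S) h₃ + C (S' 1 1) * aeval (ofMatrix S) h₄) := by
  have e : ∀ i j, (C (S' i 0) * C (S 0 j) + C (S' i 1) * C (S 1 j) : MvPolynomial (Fin 4) K) =
      C ((1 : Matrix (Fin 2) (Fin 2) K) i j) := by
    intro i j
    rw [← mul_eq_one_comm.1 h, Matrix.mul_apply, Fin.sum_univ_two]
    simp
  have e00 := e 0 0
  have e01 := e 0 1
  have e10 := e 1 0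
  have e11 := e 1 1
  simp at e00 e01 e10 e11
  have l : ∀ (a b : K) (p q : MvPolynomial (Fin 2) K),
      liftXY (C a * p + C b * q) = C a * liftXY p + C b * liftXY q := by
    intro a b p q
    simp [liftXY]
  have x2 : ofMatrix (diagTwice S) 2 = C (S 0 0) * X 2 + C (S 0 1) * X 3 := by
    simp [ofMatrix, diagTwice, Fin.sum_univ_four]
  have x3 : ofMatrix (diagTwice S) 3 = C (S 1 0) * X 2 + C (S 1 1) * X 3 := by
    simp [ofMatrix, diagTwice, Fin.sum_univ_four]
  ext1 i
  rw [conj_apply, Fin.sum_univ_four]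
  change C (diagTwice S' i 0) * aeval (ofMatrix (diagTwice S)) _ +
    C (diagTwice S' i 1) * aeval (ofMatrix (diagTwice S)) _ +
    C (diagTwice S' i 2) * aeval (ofMatrix (diagTwice S)) _ +
    C (diagTwice S' i 3) * aeval (ofMatrix (diagTwice S)) _ = _
  simp only [tildeMap, l, Matrix.cons_val, map_add, aeval_X, aeval_diagTwice_liftXY, x2, x3]
  fin_cases i
  · simp [diagTwice]
    linear_combination X 2 * e00 + X 3 * e01
  · simp [diagTwice]
    linear_combination X 2 * e10 + X 3 * e11
  · simp [diagTwice]
  · simp [diagTwice]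

lemma pderiv_liftXY_eq_zero {K : Type*} [Field K] (p : MvPolynomial (Fin 2) K) {i : Fin 4}
    (hi : 2 ≤ i) : pderiv i (liftXY p) = 0 := by
  classical
  refine pderiv_eq_zero_of_notMem_vars fun h => ?_
  obtain ⟨j, -, hj⟩ := Finset.mem_image.1 (vars_rename _ _ h)
  have := congrArg Fin.val hj
  simp at this
  have : 2 ≤ i.val := hi
  omega

/-- The traces of the first three powers of the Jacobian vanish; Newton's identities turn this into
the three equations, after division by 2 and 3. -/
lemma pderiv_equations_of_isNilpotent {K : Type*} [Field K] [CharZero K]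
    {P Q R : MvPolynomial (Fin 2) K} (h : IsNilpotent (tildeMap P Q R 0).jacobian) :
    pderiv 0 P + pderiv 1 Q = 0 ∧
    pderiv 0 P * pderiv 1 Q - pderiv 1 P * pderiv 0 Q = pderiv 0 R ∧
    pderiv 0 R * pderiv 1 Q = pderiv 1 R * pderiv 0 Q := by
  let L : MvPolynomial (Fin 2) K →+* MvPolynomial (Fin 4) K :=
    (rename (Fin.castLE (by norm_num : 2 ≤ 4))).toRingHom
  have hL : Function.Injective L := rename_injective _ (Fin.castLE_injective _)
  let M : Matrix (Fin 4) (Fin 4) (MvPolynomial (Fin 2) K) :=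
    !![pderiv 0 P, pderiv 1 P, 1, 0; pderiv 0 Q, pderiv 1 Q, 0, 1;
      pderiv 0 R, pderiv 1 R, 0, 0; 0, 0, 0, 0]
  have d0 : ∀ p : MvPolynomial (Fin 2) K, pderiv 0 (liftXY p) = L (pderiv 0 p) := fun p =>
    pderiv_rename (Fin.castLE_injective (by norm_num : 2 ≤ 4)) 0 p
  have d1 : ∀ p : MvPolynomial (Fin 2) K, pderiv 1 (liftXY p) = L (pderiv 1 p) := fun p =>
    pderiv_rename (Fin.castLE_injective (by norm_num : 2 ≤ 4)) 1 p
  have d2 : ∀ p : MvPolynomial (Fin 2) K, pderiv 2 (liftXY p) = 0 := fun p =>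
    pderiv_liftXY_eq_zero p (by decide)
  have d3 : ∀ p : MvPolynomial (Fin 2) K, pderiv 3 (liftXY p) = 0 := fun p =>
    pderiv_liftXY_eq_zero p (by decide)
  have hJ : (tildeMap P Q R 0).jacobian = L.mapMatrix M := by
    ext1 i j
    fin_cases i <;> fin_cases j <;>
      simp [jacobian, tildeMap, M, d0, d1, d2, d3, pderiv_X]
  rw [hJ] at h
  have hM : IsNilpotent M := (IsNilpotent.map_iff (f := L.mapMatrix) (fun A B hAB => by
    ext1 i j
    exact hL (congrFun (congrFun hAB i) j))).1 h
  have t1 := (Matrix.isNilpotent_trace_of_isNilpotent hM).eq_zero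
  have t2 := (Matrix.isNilpotent_trace_of_isNilpotent (hM.pow_succ 1)).eq_zero
  have t3 := (Matrix.isNilpotent_trace_of_isNilpotent (hM.pow_succ 2)).eq_zero
  simp [Matrix.trace, Fin.sum_univ_four, M] at t1
  simp [Matrix.trace, pow_succ, Fin.sum_univ_four, M] at t2
  simp [Matrix.trace, pow_succ, Fin.sum_univ_four, M] at t3
  refine ⟨t1, ?_, ?_⟩
  · have h2 : (2 : MvPolynomial (Fin 2) K) ≠ 0 := two_ne_zero
    refine mul_left_cancel₀ h2 ?_
    linear_combination (pderiv 0 P + pderiv 1 Q) * t1 - t2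
  · have h3 : (3 : MvPolynomial (Fin 2) K) ≠ 0 := OfNat.ofNat_ne_zero 3
    refine mul_left_cancel₀ h3 ?_
    linear_combination -t3 + ((pderiv 0 P + pderiv 1 Q) ^ 2 + 3 * pderiv 0 R
      - 3 * (pderiv 0 P * pderiv 1 Q - pderiv 1 P * pderiv 0 Q)) * t1

/-- A linear change of variables that kills the last component. -/
lemma exists_conj_tildeMap_last_eq_zero {K : Type*} [Field K]
    {h₁ h₂ h₃ h₄ : MvPolynomial (Fin 2) K}
    (hdep : ¬ LinearIndependent K (tildeMap h₁ h₂ h₃ h₄)) :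
    ∃ (T : GL (Fin 4) K) (P Q R : MvPolynomial (Fin 2) K),
      conj T (tildeMap h₁ h₂ h₃ h₄) = tildeMap P Q R 0 := by
  rw [Fintype.linearIndependent_iff] at hdep
  push Not at hdep
  obtain ⟨g, hg, i, hi⟩ := hdep
  rw [Fin.sum_univ_four] at hg
  have lz : ∀ (p : MvPolynomial (Fin 2) K), pderiv 2 (liftXY p) = 0 ∧ pderiv 3 (liftXY p) = 0 :=
    fun p => ⟨pderiv_liftXY_eq_zero p (by decide), pderiv_liftXY_eq_zero p (by decide)⟩
  have g0 : g 0 = 0 := by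
    have := congrArg (pderiv 2) hg
    simpa [tildeMap, lz, pderiv_X, Pi.single_apply, smul_eq_C_mul] using this
  have g1 : g 1 = 0 := by
    have := congrArg (pderiv 3) hg
    simpa [tildeMap, lz, pderiv_X, Pi.single_apply, smul_eq_C_mul] using this
  have h34 : C (g 2) * h₃ + C (g 3) * h₄ = 0 := by
    apply rename_injective (Fin.castLE (by norm_num : 2 ≤ 4)) (Fin.castLE_injective _)
    simpa [tildeMap, liftXY, g0, g1, smul_eq_C_mul] using hg
  by_cases g3 : g 3 = 0
  · have g2 : g 2 ≠ 0 := by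
      fin_cases i
      · exact absurd g0 hi
      · exact absurd g1 hi
      · exact hi
      · exact absurd g3 hi
    have h3 : h₃ = 0 := by simpa [g3, g2] using h34
    have hS : !![0, 1; 1, 0] * !![0, 1; 1, 0] = (1 : Matrix (Fin 2) (Fin 2) K) := by
      simp [Matrix.one_fin_two]
    have h := conj_tildeMap _ _ hS h₁ h₂ h₃ h₄
    have h0 : C ((!![0, 1; 1, 0] : Matrix (Fin 2) (Fin 2) K) 1 0) *
        aeval (ofMatrix !![0, 1; 1, 0]) h₃ +
        C ((!![0, 1; 1, 0] : Matrix (Fin 2) (Fin 2) K) 1 1) *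
        aeval (ofMatrix !![0, 1; 1, 0]) h₄ = 0 := by
      simp [h3]
    rw [h0] at h
    exact ⟨_, _, _, _, h⟩
  -- The inverse matrix has second row `(g 2, g 3)`, so the new last component is the dependence
  -- relation itself.
  · have hS : !![1, 0; -(g 2 / g 3), 1 / g 3] * !![1, 0; g 2, g 3] =
        (1 : Matrix (Fin 2) (Fin 2) K) := by
      simp [Matrix.one_fin_two, g3]
      ring
    have h := conj_tildeMap _ _ hS h₁ h₂ h₃ h₄
    have h0 := congrArg (aeval (ofMatrix !![1, 0; -(g 2 / g 3), 1 / g 3])) h34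
    simp only [map_add, map_mul, algHom_C, algebraMap_eq, map_zero] at h0
    refine ⟨_, _, _, _, h.trans (congrArg _ ?_)⟩
    exact h0

end PolyMap

/-! ### Assembly of the two normal forms -/

open MvPolynomial PolyMap in
theorem mainTheorem7 {K : Type*} [Field K] [CharZero K]
    (h₁ h₂ h₃ h₄ : MvPolynomial (Fin 2) K)
    (hnil : IsNilpotent (PolyMap.tildeMap h₁ h₂ h₃ h₄).jacobian)
    (hdep : ¬ LinearIndependent K (PolyMap.tildeMap h₁ h₂ h₃ h₄)) :
    ∃ (T : GL (Fin 4) K) (H : PolyMap 4 K),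
      PolyMap.conj T (PolyMap.tildeMap h₁ h₂ h₃ h₄) = ![0, MvPolynomial.X 3, 0, 0] + H ∧
      (PolyMap.IsTriangularForm H ∨ PolyMap.IsParabolicForm H) := by
  obtain ⟨T, P, Q, R, hT⟩ := exists_conj_tildeMap_last_eq_zero hdep
  have hn := isNilpotent_jacobian_conj T hnil
  rw [hT] at hn
  obtain ⟨e1, e2, e3⟩ := pderiv_equations_of_isNilpotent hn
  by_cases hQ : pderiv 0 Q = 0
  · obtain ⟨a, c, β, rfl, rfl, rfl⟩ := triangular_of_pderiv_zero_eq_zero e1 e2 e3 hQ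
    refine ⟨T, ![X 2 + Polynomial.aeval (X 1) a, C β, Polynomial.aeval (X 1) c, 0], ?_,
      Or.inl ⟨a, c, β, rfl⟩⟩
    have hl : ∀ q : Polynomial K, liftXY (Polynomial.aeval (X 1) q) =
        Polynomial.aeval (X 1 : MvPolynomial (Fin 4) K) q := by
      intro q
      rw [liftXY, ← Polynomial.aeval_algHom_apply, rename_X]
      rfl
    rw [hT, tildeMap, hl, hl]
    simp [liftXY]
  · obtain ⟨α, τ, hα⟩ := exists_pderiv_one_eq_mul_pderiv_zero e1 e2 e3 hQ
    -- The shear `x ↦ x + τy` cancels the term `-τ` in `hα`.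
    have hS : !![1, τ; 0, 1] * !![1, -τ; 0, 1] = (1 : Matrix (Fin 2) (Fin 2) K) := by
      simp [Matrix.one_fin_two]
    have hT' := conj_tildeMap _ _ hS P Q R 0
    simp only [Matrix.of_apply, Matrix.cons_val', Matrix.cons_val_zero, Matrix.cons_val_one,
      Matrix.cons_val_fin_one, C_1, zero_mul, one_mul, zero_add, map_zero, mul_zero,
      add_zero] at hT'
    have hn' := isNilpotent_jacobian_conj (diagTwiceGL _ _ hS) hn
    rw [hT'] at hn'
    obtain ⟨f1, f2, f3⟩ := pderiv_equations_of_isNilpotent hn'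
    set S : Matrix (Fin 2) (Fin 2) K := !![1, τ; 0, 1]
    set S' : Matrix (Fin 2) (Fin 2) K := !![1, -τ; 0, 1]
    have s0 : ofMatrix S 0 = X 0 + C τ * X 1 := by simp [ofMatrix, S, Fin.sum_univ_two]
    have s1 : ofMatrix S 1 = X 1 := by simp [ofMatrix, S, Fin.sum_univ_two]
    have hq0 : pderiv 0 (aeval (ofMatrix S) Q) = aeval (ofMatrix S) (pderiv 0 Q) := by
      rw [pderiv_aeval, Fin.sum_univ_two, s0, s1]
      simp
    have hq1 : pderiv 1 (aeval (ofMatrix S) Q) =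
        C (2 * α) * X 1 * pderiv 0 (aeval (ofMatrix S) Q) := by
      rw [hq0, pderiv_aeval, Fin.sum_univ_two, s0, s1, hα]
      simp [s1, algebraMap_eq]
      ring
    have hq : pderiv 0 (aeval (ofMatrix S) Q) ≠ 0 := by
      rw [hq0]
      intro h0
      have h4 := congrArg (aeval (ofMatrix S')) h0
      rw [aeval_ofMatrix_aeval_ofMatrix, hS, map_zero] at h4
      rw [ofMatrix_one, aeval_X_left_apply] at h4
      exact hQ h4
    obtain ⟨g, δ, ρ, ε, k1, k2, k3⟩ := parabolic_of_pderiv_one_eq f1 f2 f3 hq hq1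
    refine ⟨T * diagTwiceGL S S' hS, _, ?_, Or.inr ⟨g, _, α, δ, ρ, ε, rfl, rfl⟩⟩
    rw [PolyMap.conj_mul, hT, hT', k2, k3, k1, tildeMap]
    have hl : liftXY (Polynomial.aeval (X 0 + C α * X 1 ^ 2) g) =
        Polynomial.aeval (X 0 + C α * X 1 ^ 2 : MvPolynomial (Fin 4) K) g := by
      rw [liftXY, ← Polynomial.aeval_algHom_apply]
      simp
    rw [hl]
    simp only [liftXY] at hl ⊢
    ext1 i
    fin_cases i
    · simp [hl]
      ring
    · simp
    · simp [hl]
    · simp
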